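/- For finite graphs $G$ and $H$, let $\mathrm{Hom}(G,H)$ denote the polyhedral complex whose cells are indexed by the functions $\eta:V(G)\to 2^{V(H)}\setminus\{\emptyset\}$ such that, for every edge $(x,y)$ of $G$, every $\tilde x\in\eta(x)$ and every $\tilde y\in\eta(y)$, the pair $(\tilde x,\tilde y)$ is an edge of $H$. The closed cell indexed by $\eta$ is the product over $x\in V(G)$ of the simplices with vertex sets $\eta(x)$, and its faces are the closed cells indexed by those $\tilde\eta$ with $\tilde\eta(x)\subseteq\eta(x)$ for all $x$. Let $K_n$ denote the complete graph on $n$ vertices (without loops). For all integers $0\le m\le n$, the complex $\mathrm{Hom}(K_m,K_n)$ is homotopy equivalent to a wedge of finitely many spheres of dimension $n-m$. For $m\ge 2$ at least one sphere can be taken; the wedge of no spheres, which is needed for $m\le 1$ only, is a point. -/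

import Mathlib

open scoped ContinuousMap

/-- `η : V(G) → 2^{V(H)} ∖ {∅}` indexes a cell of `Hom(G, H)` if, whenever `(v, w)` is an edge
of `G`, every element of `η v` is adjacent in `H` to every element of `η w`. -/
def IsHomCell {V W : Type*} (G : SimpleGraph V) (H : SimpleGraph W) (η : V → Finset W) : Prop :=
  (∀ v, (η v).Nonempty) ∧
    ∀ v w, G.Adj v w → ∀ a ∈ η v, ∀ b ∈ η w, H.Adj a b

/-- The closed cell indexed by `η`: the product, over the vertices `v` of `G`, of the simplices
with vertex set `η v`, realized as faces of the standard simplex on `V(H)`. -/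
def homClosedCell {V W : Type*} [Fintype W] (η : V → Finset W) : Set (V → W → ℝ) :=
  {x | ∀ v, x v ∈ stdSimplex ℝ W ∧ ∀ a, a ∉ η v → x v a = 0}

/-- The polyhedral complex `Hom(G, H)` of two finite graphs: the union of its closed cells, a
subcomplex of the product of standard simplices `∏_{v ∈ V(G)} Δ^{V(H)}`. Coerced to a type it
carries the subspace topology of `ℝ^{V(G) × V(H)}`, which is the topology of the (finite) cell
complex. The closed cell of `η'` is a face of that of `η` iff `η' v ⊆ η v` for all `v`. -/
def HomComplex {V W : Type*} [Fintype V] [Fintype W] (G : SimpleGraph V) (H : SimpleGraph W) :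
    Set (V → W → ℝ) :=
  ⋃ η ∈ {η : V → Finset W | IsHomCell G H η}, homClosedCell η

/-- The relation that glues all the base points `x i` to one additional point. -/
def wedgeRel {ι : Type*} {X : ι → Type*} (x : ∀ i, X i) (p q : Unit ⊕ (Σ i, X i)) : Prop :=
  p = Sum.inl () ∧ ∃ i, q = Sum.inr ⟨i, x i⟩

/-- The wedge of a family of pointed spaces: the disjoint union of a point and of all the spaces,
with that point and all the base points identified. The empty wedge is a point. -/
abbrev Wedge {ι : Type*} {X : ι → Type*} (x : ∀ i, X i) : Type _ :=
  Quot (wedgeRel x)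

/-- The standard sphere `S^d`, the unit sphere of `ℝ^{d+1}`. -/
abbrev StdSphere (d : ℕ) : Type :=
  Metric.sphere (0 : EuclideanSpace ℝ (Fin (d + 1))) 1

/-- The base point `(1, 0, …, 0)` of `S^d`. -/
noncomputable def StdSphere.base (d : ℕ) : StdSphere d :=
  ⟨EuclideanSpace.single 0 1, by simp⟩

/-- The wedge of `k` copies of `S^d`. -/
abbrev SphereWedge (k d : ℕ) : Type :=
  Wedge fun _ : Fin k => StdSphere.base d

/-! ### Homotopies through maps with a prescribed property. -/

namespace ContinuousMap

/-! A cell of `Hom(K_m, K_n)` is a multicoloring: pairwise disjoint nonempty sets of colors, one for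
each vertex. The proof finds a contractible subcomplex `Y` (`IsCore`) containing every cell that
omits a color. The remaining cells are ordered partitions of the `n` colors into `m` blocks; their
open cells are open in the complex and homeomorphic to `ℝ^(n-m)`. Collapsing `Y` is a homotopy
equivalence, and the quotient is a wedge of one `(n-m)`-sphere per remaining cell
(`nonempty_homotopyEquiv_wedge`).

The core comes from induction on the number of colors (`exists_isCore`). Remove a color `c`. Let `A`
be the complex of colorings without `c`, `Y` a core of `A`, and `C i` a core of the colorings in
which `i` receives exactly `{c}`. Sending the `i`-th set to `{c}` maps `A` into `C i`, since it
frees the old colors of `i`. The new core is the mapping cylinder of `A → C i₀` for one vertex `i₀`,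
together with those of `Y → C i` for the other `i`. Each cylinder retracts to a contractible `C i`,
and each new one meets the union of the earlier ones in `Y`, so the union is contractible
(`isCore_union_cylinder`).

`HasNullDeformation` plays the part of the homotopy extension property, both in gluing contractible
pieces and in collapsing. -/

theorem HomotopicWith.comp_comp {X X' Y Y' : Type*} [TopologicalSpace X] [TopologicalSpace X']
    [TopologicalSpace Y] [TopologicalSpace Y'] {P : C(X, Y) → Prop} {P' : C(X', Y') → Prop}
    {f g : C(X, Y)} (h : HomotopicWith f g P) (k : C(Y, Y')) (l : C(X', X))
    (hP : ∀ u, P u → P' (k.comp (u.comp l))) :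
    HomotopicWith (k.comp (f.comp l)) (k.comp (g.comp l)) P' := by
  obtain ⟨F⟩ := h
  exact ⟨{ toFun := fun p => k (F (p.1, l p.2))
           continuous_toFun := by fun_prop
           map_zero_left := fun x => by simp
           map_one_left := fun x => by simp
           prop' := fun t => hP _ (F.prop t) }⟩

theorem Homotopic.homotopicWith {X Y : Type*} [TopologicalSpace X] [TopologicalSpace Y]
    {f g : C(X, Y)} (h : Homotopic f g) : HomotopicWith f g fun _ => True := by
  obtain ⟨F⟩ := h
  exact ⟨{ toHomotopy := F, prop' := fun _ => trivial }⟩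

end ContinuousMap

/-! ### Gluing and collapsing by null deformations. -/

/-- The identity of `B` can be deformed, through self-maps of `B` that preserve `Z`, to a map that
sends all of `Z` to one point of `Z`. -/
def HasNullDeformation {E : Type*} [TopologicalSpace E] (B Z : Set E) : Prop :=
  ∃ f : C(B, B), ∃ v ∈ Z,
    ContinuousMap.HomotopicWith (ContinuousMap.id B) f (fun g => ∀ x : B, x.1 ∈ Z → (g x).1 ∈ Z) ∧
      ∀ x : B, x.1 ∈ Z → (f x).1 = v

/-- A map `K` homotopic to the identity crushes `P` to a point. It then suffices to contract `K` on
`Q` through maps constant on `P ∩ Q`, because such a homotopy extends over `P`. -/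
theorem contractibleSpace_union {E : Type*} [TopologicalSpace E] {P Q : Set E} (hP : IsClosed P)
    (hQ : IsClosed Q) (hPQ : HasNullDeformation (P ∪ Q) P) (hR : HasNullDeformation Q (P ∩ Q))
    [ContractibleSpace Q] : ContractibleSpace (P ∪ Q : Set E) := by
  classical
  obtain ⟨K, p0, hp0, hK, hKp⟩ := hPQ
  obtain ⟨f, r0, hr0, hf, hfr⟩ := hR
  obtain ⟨q0, hq0⟩ := id_nullhomotopic Q
  let j : C(Q, (P ∪ Q : Set E)) := ⟨Set.inclusion Set.subset_union_right, by fun_prop⟩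
  let C : C(Q, (P ∪ Q : Set E)) → Prop := fun g => ∀ x y : Q, x.1 ∈ P → y.1 ∈ P → g x = g y
  have h1 : ContinuousMap.HomotopicWith (K.comp j) ((K.comp j).comp f) C :=
    hf.comp_comp (K.comp j) (ContinuousMap.id Q) fun u hu x y hx hy => by
      have e (x : Q) (hx : x.1 ∈ P) : ((K.comp j) (u x)).1 = p0 := hKp _ (hu x ⟨hx, x.2⟩).1
      exact Subtype.ext ((e x hx).trans (e y hy).symm)
  have h2 : ContinuousMap.HomotopicWith ((K.comp j).comp f)
      ((K.comp j).comp ((ContinuousMap.const Q q0).comp f)) C :=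
    hq0.homotopicWith.comp_comp (K.comp j) f fun u _ x y hx hy => by
      have : f x = f y :=
        Subtype.ext ((hfr x ⟨hx, x.2⟩).trans (hfr y ⟨hy, y.2⟩).symm)
      simp [this]
  obtain ⟨F⟩ := h1.trans h2
  -- On `P` outside `Q`, use the common value on `P ∩ Q`, read off at `r0`.
  let G : unitInterval × (P ∪ Q : Set E) → (P ∪ Q : Set E) := fun p =>
    if h : p.2.1 ∈ Q then F (p.1, ⟨p.2.1, h⟩) else F (p.1, ⟨r0, hr0.2⟩)
  have hGP (t : unitInterval) (x : (P ∪ Q : Set E)) (hx : x.1 ∈ P) :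
      G (t, x) = F (t, ⟨r0, hr0.2⟩) := by
    by_cases h : x.1 ∈ Q
    · simp only [G, h, dif_pos]
      exact F.prop t ⟨x.1, h⟩ ⟨r0, hr0.2⟩ hx hr0.1
    · simp [G, h]
  have hG : Continuous G := by
    rw [← continuousOn_univ]
    have hu : (Set.univ : Set (unitInterval × (P ∪ Q : Set E))) =
        {p | p.2.1 ∈ P} ∪ {p | p.2.1 ∈ Q} := by
      ext ⟨t, x, hx⟩
      simpa using hx
    rw [hu]
    refine ContinuousOn.union_of_isClosed ?_ ?_ (hP.preimage (by fun_prop))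
      (hQ.preimage (by fun_prop))
    · have : Continuous fun p : unitInterval × (P ∪ Q : Set E) => F (p.1, ⟨r0, hr0.2⟩) := by
        fun_prop
      exact this.continuousOn.congr fun p hp => hGP p.1 p.2 hp
    · rw [continuousOn_iff_continuous_domRestrict]
      have : Continuous fun p : {p : unitInterval × (P ∪ Q : Set E) | p.2.1 ∈ Q} =>
          F (p.1.1, ⟨p.1.2.1, p.2⟩) := by fun_prop
      refine this.congr fun p => ?_
      have := p.2
      simp only [Set.mem_ofPred_eq] at this
      simp [G, this]
  rw [contractible_iff_id_nullhomotopic]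
  refine ⟨K (j q0), ContinuousMap.Homotopic.trans ⟨hK.some.toHomotopy⟩
    ⟨{ toFun := G, continuous_toFun := hG, map_zero_left := ?_, map_one_left := ?_ }⟩⟩
  · intro x
    by_cases h : x.1 ∈ Q
    · simp [G, h, j]
    · have hx : x.1 ∈ P := x.2.resolve_right h
      rw [hGP _ _ hx]
      simp only [ContinuousMap.HomotopyWith.apply_zero, ContinuousMap.comp_apply]
      exact Subtype.ext ((hKp _ hr0.1).trans (hKp _ hx).symm)
  · intro x
    by_cases h : x.1 ∈ Q <;> simp [G, h]

/-- The final map `f` descends along `q` to a homotopy inverse. The deformation descends too: `q` is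
proper, so its product with the interval is still a quotient map. -/
theorem nonempty_homotopyEquiv_of_collapse {E T : Type*} [TopologicalSpace E] [TopologicalSpace T]
    [T2Space T] {X Y : Set E} (hX : IsCompact X) (h : HasNullDeformation X Y) (q : C(X, T))
    (hq : Function.Surjective q)
    (hqY : ∀ x x', q x = q x' ↔ x = x' ∨ x.1 ∈ Y ∧ x'.1 ∈ Y) : Nonempty (X ≃ₕ T) := by
  have : CompactSpace X := isCompact_iff_compactSpace.1 hX
  obtain ⟨f, v, hv, hf, hfv⟩ := h
  obtain ⟨F⟩ := hf
  have hqp : IsProperMap q := q.continuous.isProperMap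
  have hqq : Topology.IsQuotientMap q := hqp.isClosedMap.isQuotientMap q.continuous hq
  have hIp : IsProperMap (Prod.map id q : unitInterval × X → unitInterval × T) :=
    isProperMap_id.prodMap hqp
  have hIq : Topology.IsQuotientMap (⟨Prod.map id q, by fun_prop⟩ :
      C(unitInterval × X, unitInterval × T)) :=
    hIp.isClosedMap.isQuotientMap (by fun_prop) (Function.surjective_id.prodMap hq)
  have hfac : Function.FactorsThrough f q := fun x x' hxx => by
    rcases (hqY x x').1 hxx with rfl | ⟨h1, h2⟩
    · rfl
    · exact Subtype.ext ((hfv x h1).trans (hfv x' h2).symm)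
  have hIfac : Function.FactorsThrough
      (q.comp F.toContinuousMap : C(unitInterval × X, T))
      (⟨Prod.map id q, by fun_prop⟩ : C(unitInterval × X, unitInterval × T)) := by
    rintro ⟨t, x⟩ ⟨t', x'⟩ hxx
    simp only [ContinuousMap.coe_mk, Prod.map_apply, id_eq, Prod.mk.injEq] at hxx
    obtain ⟨rfl, hxx⟩ := hxx
    rcases (hqY x x').1 hxx with rfl | ⟨h1, h2⟩
    · rfl
    · exact (hqY _ _).2 (Or.inr ⟨F.prop t x h1, F.prop t x' h2⟩)
  let p : C(T, X) := hqq.lift f hfac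
  have hp (x : X) : p (q x) = f x := congr($(hqq.lift_comp f hfac) x)
  let H : C(unitInterval × T, T) := hIq.lift _ hIfac
  have hH (t : unitInterval) (x : X) : H (t, q x) = q (F (t, x)) :=
    congr($(hIq.lift_comp _ hIfac) (t, x))
  refine ⟨⟨q, p, ?_, ?_⟩⟩
  · have : p.comp q = f := ContinuousMap.ext hp
    rw [this]
    exact ContinuousMap.Homotopic.symm ⟨F.toHomotopy⟩
  · refine ContinuousMap.Homotopic.symm ⟨⟨H, fun y => ?_, fun y => ?_⟩⟩
    · obtain ⟨x, rfl⟩ := hq y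
      simpa using hH 0 x
    · obtain ⟨x, rfl⟩ := hq y
      simpa [hp] using hH 1 x

/-! ### Subcomplexes of a product of simplices. -/

section CellComplex

variable {V W : Type*} [Fintype W]

open Classical in
/-- The positive coordinates of `x`, one set for every factor. -/
noncomputable def posSupport (x : V → W → ℝ) : V → Finset W :=
  fun v => Finset.univ.filter fun a => 0 < x v a

@[simp]
theorem mem_posSupport {x : V → W → ℝ} {v : V} {a : W} : a ∈ posSupport x v ↔ 0 < x v a := by
  simp [posSupport]

/-- The points of a product of standard simplices whose support belongs to `Z`. -/
def realization (Z : Set (V → Finset W)) : Set (V → W → ℝ) :=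
  {x | (∀ v, x v ∈ stdSimplex ℝ W) ∧ posSupport x ∈ Z}

/-- `Z` contains all faces of its cells. -/
def IsFaceClosed (Z : Set (V → Finset W)) : Prop :=
  ∀ s ∈ Z, ∀ s' ≤ s, (∀ v, (s' v).Nonempty) → s' ∈ Z

theorem posSupport_nonempty {x : V → W → ℝ} {v : V} (h : x v ∈ stdSimplex ℝ W) :
    (posSupport x v).Nonempty := by
  by_contra hne
  have : ∑ a, x v a ≤ 0 := Finset.sum_nonpos fun a _ => by
    by_contra ha
    exact hne ⟨a, mem_posSupport.2 (not_le.1 ha)⟩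
  linarith [h.2]

theorem realization_mono {Z Z' : Set (V → Finset W)} (h : Z ⊆ Z') :
    realization Z ⊆ realization Z' := fun _ hx => ⟨hx.1, h hx.2⟩

theorem realization_union (Z Z' : Set (V → Finset W)) :
    realization (Z ∪ Z') = realization Z ∪ realization Z' := by
  ext x
  simp only [realization, Set.mem_ofPred_eq, Set.mem_union]
  tauto

theorem realization_inter (Z Z' : Set (V → Finset W)) :
    realization (Z ∩ Z') = realization Z ∩ realization Z' := by
  ext x
  simp only [realization, Set.mem_ofPred_eq, Set.mem_inter_iff]
  tauto

theorem isClosed_realization [Finite V] {Z : Set (V → Finset W)} (hZ : IsFaceClosed Z) :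
    IsClosed (realization Z) := by
  -- A support lies in the face-closed `Z` exactly when it contains no family of nonempty sets
  -- outside `Z`.
  have : realization Z = {x | ∀ v, x v ∈ stdSimplex ℝ W} ∩
      ⋂ s ∈ {s : V → Finset W | s ∉ Z ∧ ∀ v, (s v).Nonempty},
        ⋃ v, ⋃ a ∈ s v, {x : V → W → ℝ | x v a ≤ 0} := by
    ext x
    simp only [realization, Set.mem_ofPred_eq, Set.mem_inter_iff, Set.mem_iInter, Set.mem_iUnion,
      exists_prop, and_imp]
    refine and_congr_right fun hx => ⟨fun h s hs hne => ?_, fun h => ?_⟩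
    · by_contra! hc
      exact hs (hZ _ h s (fun v a ha => mem_posSupport.2 (hc v a ha)) hne)
    · by_contra hc
      obtain ⟨v, a, ha, h0⟩ := h _ hc fun v => posSupport_nonempty (hx v)
      exact (mem_posSupport.1 ha).not_ge h0
  rw [this]
  refine IsClosed.inter ?_ ?_
  · simp only [Set.ofPred_forall]
    exact isClosed_iInter fun v => (isClosed_stdSimplex ℝ W).preimage (continuous_apply v)
  · refine isClosed_biInter fun s _ => isClosed_iUnion_of_finite fun v =>
      Set.Finite.isClosed_biUnion (s v).finite_toSet fun a _ => ?_
    exact isClosed_le (by fun_prop) continuous_const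

theorem isCompact_realization [Finite V] {Z : Set (V → Finset W)} (hZ : IsFaceClosed Z) :
    IsCompact (realization Z) := by
  refine (isCompact_univ_pi fun _ : V => isCompact_stdSimplex ℝ W).of_isClosed_subset
    (isClosed_realization hZ) fun x hx v _ => hx.1 v

/-- Lower every coordinate by `ε`, cut off at zero, and rescale. -/
noncomputable def truncate (ε : ℝ) (x : V → W → ℝ) : V → W → ℝ :=
  fun v a => max (x v a - ε) 0 / ∑ b, max (x v b - ε) 0

theorem truncate_denom_pos {ε : ℝ} {f : W → ℝ} (hf : f ∈ stdSimplex ℝ W)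
    (hε : Fintype.card W * ε < 1) : 0 < ∑ b, max (f b - ε) 0 := by
  have h : ∑ b, (f b - ε) ≤ ∑ b, max (f b - ε) 0 :=
    Finset.sum_le_sum fun b _ => le_max_left _ _
  simp only [Finset.sum_sub_distrib, hf.2, Finset.sum_const, Finset.card_univ, nsmul_eq_mul] at h
  linarith

theorem truncate_mem_stdSimplex {ε : ℝ} {x : V → W → ℝ} {v : V} (hx : x v ∈ stdSimplex ℝ W)
    (hε : Fintype.card W * ε < 1) : truncate ε x v ∈ stdSimplex ℝ W := by
  have h := truncate_denom_pos hx hε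
  refine ⟨fun a => div_nonneg (le_max_right _ _) h.le, ?_⟩
  simp only [truncate, ← Finset.sum_div]
  exact div_self h.ne'

theorem mem_posSupport_truncate {ε : ℝ} {x : V → W → ℝ} {v : V} (hx : x v ∈ stdSimplex ℝ W)
    (hε : Fintype.card W * ε < 1) {a : W} : a ∈ posSupport (truncate ε x) v ↔ ε < x v a := by
  have h := truncate_denom_pos hx hε
  simp [truncate, div_pos_iff_of_pos_right h]

theorem truncate_zero {x : V → W → ℝ} (hx : ∀ v, x v ∈ stdSimplex ℝ W) : truncate 0 x = x := by
  ext v a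
  simp [truncate, max_eq_left ((hx v).1 _), (hx v).2]

theorem truncate_mem_realization {Z : Set (V → Finset W)} (hZ : IsFaceClosed Z) {ε : ℝ}
    {x : V → W → ℝ} (hx : x ∈ realization Z) (h0 : 0 ≤ ε) (hε : Fintype.card W * ε < 1) :
    truncate ε x ∈ realization Z := by
  have h (v) := truncate_mem_stdSimplex (hx.1 v) hε
  refine ⟨h, hZ _ hx.2 _ (fun v a ha => ?_) fun v => posSupport_nonempty (h v)⟩
  rw [mem_posSupport_truncate (hx.1 v) hε] at ha
  exact mem_posSupport.2 (h0.trans_lt ha)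

/-- Tietze extends the contraction to a map `g` on the ambient space. Adding `y - g (0, y)` makes it
start at the identity and changes nothing over `Z`. -/
theorem exists_contraction [Finite V] {Z : Set (V → W → ℝ)} (hZ : IsClosed Z) [ContractibleSpace Z] :
    ∃ (c : C(unitInterval × (V → W → ℝ), V → W → ℝ)) (v : V → W → ℝ), v ∈ Z ∧
      (∀ y, c (0, y) = y) ∧ (∀ t, ∀ z ∈ Z, c (t, z) ∈ Z) ∧ ∀ z ∈ Z, c (1, z) = v := by
  obtain ⟨v, ⟨F⟩⟩ := id_nullhomotopic Z
  have hZ' : IsClosed {p : unitInterval × (V → W → ℝ) | p.2 ∈ Z} := hZ.preimage continuous_snd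
  let f : C({p : unitInterval × (V → W → ℝ) | p.2 ∈ Z}, V → W → ℝ) :=
    ⟨fun p => (F (p.1.1, ⟨p.1.2, p.2⟩)).1, by fun_prop⟩
  obtain ⟨g, hg⟩ := f.exists_restrict_eq hZ'
  have hg' (t : unitInterval) (z : V → W → ℝ) (hz : z ∈ Z) : g (t, z) = (F (t, ⟨z, hz⟩)).1 :=
    congr($hg ⟨(t, z), hz⟩)
  have hc (t : unitInterval) (z : V → W → ℝ) (hz : z ∈ Z) :
      g (t, z) + (z - g (0, z)) = (F (t, ⟨z, hz⟩)).1 := by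
    simp [hg' _ _ hz]
  refine ⟨⟨fun p => g p + (p.2 - g (0, p.2)), by fun_prop⟩, v, v.2, fun y => ?_,
    fun t z hz => ?_, fun z hz => ?_⟩
  · simp
  · simp only [ContinuousMap.coe_mk, hc t z hz, Subtype.coe_prop]
  · simp only [ContinuousMap.coe_mk, hc 1 z hz]
    simp

/-- Truncation carries a neighborhood of `Z` into `Z`. Deform to the truncation, then run the
contraction of `Z` with a time scale `φ` that is `1` on `Z` and vanishes where the truncated point
may lie outside `Z`. -/
theorem hasNullDeformation_realization [Finite V] {B Z : Set (V → Finset W)} (hB : IsFaceClosed B)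
    (hZ : IsFaceClosed Z) (hZB : Z ⊆ B) [ContractibleSpace (realization Z)] :
    HasNullDeformation (realization B) (realization Z) := by
  obtain ⟨c, v, hv, hc0, hcZ, hc1⟩ := exists_contraction (isClosed_realization hZ)
  obtain ⟨ε, hε0, hε⟩ : ∃ ε : ℝ, 0 < ε ∧ Fintype.card W * ε < 1 := by
    refine ⟨1 / (Fintype.card W + 1), by positivity, ?_⟩
    rw [mul_one_div, div_lt_one (by positivity)]
    linarith
  have hεt (t : unitInterval) : Fintype.card W * ((t : ℝ) * ε) < 1 := by
    refine lt_of_le_of_lt ?_ hε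
    gcongr
    exact mul_le_of_le_one_left hε0.le t.2.2
  -- Contains every point of `realization B` whose truncation by `ε` lies outside `Z`.
  let K : Set (V → W → ℝ) := ⋃ s ∈ {s : V → Finset W | s ∉ Z ∧ ∀ v, (s v).Nonempty},
    ⋂ v, ⋂ a ∈ s v, {x | ε ≤ x v a}
  have hK : IsClosed K := by
    refine Set.Finite.isClosed_biUnion (Set.toFinite _) fun s _ => isClosed_iInter fun v =>
      isClosed_biInter fun a _ => isClosed_le continuous_const (by fun_prop)
  have hKZ : Disjoint K (realization Z) := by
    rw [Set.disjoint_left]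
    intro x hxK hxZ
    simp only [K, Set.mem_iUnion, Set.mem_iInter, Set.mem_ofPred_eq, exists_prop] at hxK
    obtain ⟨s, ⟨hs, hne⟩, hsx⟩ := hxK
    exact hs (hZ _ hxZ.2 s (fun v a ha => mem_posSupport.2 (hε0.trans_le (hsx v a ha))) hne)
  obtain ⟨φ, hφK, hφZ, hφ⟩ :=
    exists_continuous_zero_one_of_isClosed hK (isClosed_realization hZ) hKZ
  have hτ (x : V → W → ℝ) (hx : x ∈ realization B) (h0 : φ x ≠ 0) :
      truncate ε x ∈ realization Z := by
    have h (v) := truncate_mem_stdSimplex (hx.1 v) hε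
    refine ⟨h, by_contra fun hn => h0 (hφK ?_)⟩
    simp only [K, Set.mem_iUnion, Set.mem_iInter, Set.mem_ofPred_eq, exists_prop]
    exact ⟨_, ⟨hn, fun v => posSupport_nonempty (h v)⟩, fun v a ha =>
      ((mem_posSupport_truncate (hx.1 v) hε).1 ha).le⟩
  let ψ : C(V → W → ℝ, unitInterval) := ⟨fun x => ⟨φ x, hφ x⟩, by fun_prop⟩
  have hcont : Continuous fun p : unitInterval × realization B => truncate (p.1 * ε) p.2.1 := by
    have hx (v : V) (b : W) :
        Continuous fun p : unitInterval × realization B => max (p.2.1 v b - p.1 * ε) 0 :=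
      (((continuous_apply_apply v b).comp (continuous_subtype_val.comp continuous_snd)).sub
        (by fun_prop)).max continuous_const
    refine continuous_pi fun v => continuous_pi fun a => ?_
    refine (hx v a).div (continuous_finsetSum _ fun b _ => hx v b) fun p => ?_
    exact (truncate_denom_pos (p.2.2.1 v) (hεt p.1)).ne'
  let τ : C(unitInterval × realization B, realization B) :=
    ⟨fun p => ⟨truncate (p.1 * ε) p.2.1,
      truncate_mem_realization hB p.2.2 (mul_nonneg p.1.2.1 hε0.le) (hεt p.1)⟩,
      hcont.subtype_mk _⟩
  have hτ1 (x : realization B) : (τ (1, x)).1 = truncate ε x.1 := by simp [τ]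
  have hmem (t : unitInterval) (x : realization B) :
      c (t * ψ x, (τ (1, x)).1) ∈ realization B := by
    by_cases h0 : φ x = 0
    · have : ψ x = 0 := Subtype.ext h0
      rw [this, mul_zero, hc0]
      exact (τ (1, x)).2
    · rw [hτ1]
      exact realization_mono hZB (hcZ _ _ (hτ x x.2 h0))
  let G : C(unitInterval × realization B, realization B) :=
    ⟨fun p => ⟨c (p.1 * ψ p.2, (τ (1, p.2)).1), hmem p.1 p.2⟩, by fun_prop⟩
  have hZτ (t : unitInterval) (x : realization B) (hx : x.1 ∈ realization Z) :
      (τ (t, x)).1 ∈ realization Z :=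
    truncate_mem_realization hZ hx (mul_nonneg t.2.1 hε0.le) (hεt t)
  refine ⟨G.comp ⟨fun x => (1, x), by fun_prop⟩, v, hv, ContinuousMap.HomotopicWith.trans
    (g := τ.comp ⟨fun x => (1, x), by fun_prop⟩)
    ⟨{ toContinuousMap := τ, map_zero_left := ?_, map_one_left := fun x => rfl, prop' := ?_ }⟩
    ⟨{ toContinuousMap := G, map_zero_left := ?_, map_one_left := fun x => rfl, prop' := ?_ }⟩, ?_⟩
  · intro x
    refine Subtype.ext ?_
    simp only [Set.Icc.coe_zero, zero_mul, τ]
    exact truncate_zero x.2.1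
  · exact fun t x hx => hZτ t x hx
  · intro x
    refine Subtype.ext ?_
    simp only [G, zero_mul, hc0]
    rfl
  · exact fun t x hx => hcZ _ _ (hZτ 1 x hx)
  · intro x hx
    have : ψ x = 1 := Subtype.ext (hφZ hx)
    simp only [ContinuousMap.comp_apply, ContinuousMap.coe_mk, G, this, mul_one]
    exact hc1 _ (hZτ 1 x hx)

end CellComplex

theorem eq_single_of_mem_stdSimplex {W : Type*} [Fintype W] [DecidableEq W] {f : W → ℝ}
    (hf : f ∈ stdSimplex ℝ W) {c : W} (h : ∀ a, 0 < f a → a = c) : f = Pi.single c 1 := by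
  have h0 (a : W) (ha : a ≠ c) : f a = 0 :=
    le_antisymm (not_lt.1 fun hp => ha (h a hp)) (hf.1 a)
  have h1 : f c = 1 := by
    rw [← hf.2, Finset.sum_eq_single c (fun a _ ha => h0 a ha) (by simp)]
  ext a
  by_cases ha : a = c
  · subst ha; simp [h1]
  · simp [ha, h0 a ha]

/-! ### Unions and mapping cylinders of subcomplexes. -/

section Cone

variable {V W : Type*} [Fintype W]

theorem contractibleSpace_realization_union [Finite V] {P Q : Set (V → Finset W)} (hP : IsFaceClosed P)
    (hQ : IsFaceClosed Q) (h1 : ContractibleSpace (realization P))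
    (h2 : ContractibleSpace (realization Q)) (h3 : ContractibleSpace (realization (P ∩ Q))) :
    ContractibleSpace (realization (P ∪ Q)) := by
  have hPQ : IsFaceClosed (P ∪ Q) := fun s hs s' h hne =>
    hs.imp (fun hs => hP s hs s' h hne) fun hs => hQ s hs s' h hne
  have hPQ' : IsFaceClosed (P ∩ Q) := fun s hs s' h hne =>
    ⟨hP s hs.1 s' h hne, hQ s hs.2 s' h hne⟩
  have h4 := hasNullDeformation_realization hPQ hP Set.subset_union_left
  have h5 := hasNullDeformation_realization hQ hPQ' Set.inter_subset_right
  rw [realization_union] at h4 ⊢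
  rw [realization_inter] at h5
  exact contractibleSpace_union (isClosed_realization hP) (isClosed_realization hQ) h4 h5

variable [DecidableEq V] [DecidableEq W]

/-- The mapping cylinder, in the `i`-th coordinate and towards the vertex `c`, of the map from `Q`
to `C` that replaces the `i`-th set by `{c}`. -/
def cylinder (i : V) (c : W) (Q C : Set (V → Finset W)) : Set (V → Finset W) :=
  {s | s ∈ Q ∨ (c ∈ s i ∧ Function.update s i ((s i).erase c) ∈ Q) ∨ s ∈ C}

variable {i : V} {c : W} {Q C : Set (V → Finset W)}

/-- Move the `i`-th point towards the vertex `c`. -/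
noncomputable def pushTo (i : V) (c : W) (t : ℝ) (x : V → W → ℝ) : V → W → ℝ :=
  Function.update x i ((1 - t) • x i + t • Pi.single c 1)

theorem pushTo_mem_stdSimplex {t : unitInterval} {x : V → W → ℝ}
    (hx : ∀ v, x v ∈ stdSimplex ℝ W) (v : V) : pushTo i c t x v ∈ stdSimplex ℝ W := by
  by_cases hv : v = i
  · subst hv
    simp only [pushTo, Function.update_self]
    exact convex_stdSimplex ℝ W (hx v) (single_mem_stdSimplex ℝ c) (by linarith [t.2.2]) t.2.1
      (by ring)
  · simpa [pushTo, hv] using hx v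

theorem pushTo_zero {V W : Type*} [DecidableEq V] [DecidableEq W] {i : V} {c : W}
    (x : V → W → ℝ) : pushTo i c 0 x = x := by simp [pushTo]

theorem posSupport_pushTo_one (x : V → W → ℝ) :
    posSupport (pushTo i c 1 x) = Function.update (posSupport x) i {c} := by
  ext v a
  by_cases hv : v = i
  · subst hv
    by_cases ha : a = c
    · subst ha; simp [pushTo]
    · simp [pushTo, ha]
  · simp [pushTo, hv]

theorem posSupport_pushTo {t : ℝ} (h0 : 0 < t) (h1 : t < 1) {x : V → W → ℝ}
    (hx : ∀ v, x v ∈ stdSimplex ℝ W) :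
    posSupport (pushTo i c t x) = Function.update (posSupport x) i (insert c (posSupport x i)) := by
  ext v a
  by_cases hv : v = i
  · subst hv
    have : 0 < 1 - t := by linarith
    by_cases ha : a = c
    · subst ha
      have := mul_nonneg this.le ((hx v).1 a)
      simp [pushTo]
      linarith
    · simp [pushTo, ha, this]
  · simp [pushTo, hv]

/-- Moving the `i`-th point straight to `c` first inserts `c` into the `i`-th set and finally leaves
only `c`. This stays in the cylinder, ends in `C`, and fixes `C`. -/
theorem contractibleSpace_realization_cylinder (hQ : ∀ s ∈ Q, c ∉ s i) (hC : ∀ s ∈ C, s i = {c})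
    (hQC : ∀ s ∈ Q, Function.update s i {c} ∈ C) (h : ContractibleSpace (realization C)) :
    ContractibleSpace (realization (cylinder i c Q C)) := by
  have hCself (s) (hs : s ∈ C) : Function.update s i {c} = s := by
    rw [← hC s hs, Function.update_eq_self]
  have hone (s) (hs : s ∈ cylinder i c Q C) : Function.update s i {c} ∈ C := by
    rcases hs with hs | ⟨_, hs⟩ | hs
    · exact hQC s hs
    · simpa using hQC _ hs
    · rwa [hCself s hs]
  have hins (s) (hs : s ∈ cylinder i c Q C) :
      Function.update s i (insert c (s i)) ∈ cylinder i c Q C := by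
    rcases hs with hs | ⟨hc, hs⟩ | hs
    · refine Or.inr (Or.inl ⟨by simp, ?_⟩)
      simpa [Finset.erase_insert (hQ s hs)] using hs
    · refine Or.inr (Or.inl ⟨by simp, ?_⟩)
      simpa using hs
    · refine Or.inr (Or.inr ?_)
      simpa [hC s hs, hCself s hs] using hs
  have hpush (t : unitInterval) (x) (hx : x ∈ realization (cylinder i c Q C)) :
      pushTo i c t x ∈ realization (cylinder i c Q C) := by
    refine ⟨pushTo_mem_stdSimplex hx.1, ?_⟩
    rcases t.2.1.eq_or_lt with h0 | h0
    · rw [← h0, pushTo_zero]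
      exact hx.2
    rcases t.2.2.eq_or_lt with h1 | h1
    · rw [h1, posSupport_pushTo_one]
      exact Or.inr (Or.inr (hone _ hx.2))
    · rw [posSupport_pushTo h0 h1 hx.1]
      exact hins _ hx.2
  have hr (x) (hx : x ∈ realization (cylinder i c Q C)) : pushTo i c 1 x ∈ realization C := by
    refine ⟨pushTo_mem_stdSimplex (t := 1) hx.1, ?_⟩
    rw [posSupport_pushTo_one]
    exact hone _ hx.2
  have hcont : Continuous fun p : unitInterval × (V → W → ℝ) => pushTo i c p.1 p.2 := by
    unfold pushTo
    fun_prop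
  let r : C(realization (cylinder i c Q C), realization C) :=
    ⟨fun x => ⟨pushTo i c 1 x.1, hr x.1 x.2⟩,
      (hcont.comp (Continuous.prodMk (continuous_const (y := 1)) continuous_subtype_val)).subtype_mk
        _⟩
  let j : C(realization C, realization (cylinder i c Q C)) :=
    ⟨fun x => ⟨x.1, x.2.1, Or.inr (Or.inr x.2.2)⟩, by fun_prop⟩
  have hrj : r.comp j = ContinuousMap.id _ := by
    ext1 x
    refine Subtype.ext ?_
    have : x.1 i = Pi.single c 1 := eq_single_of_mem_stdSimplex (x.2.1 i) fun a ha => by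
      have : a ∈ posSupport x.1 i := mem_posSupport.2 ha
      rw [hC _ x.2.2] at this
      simpa using this
    simp [r, j, pushTo, ← this]
  have hjr : ContinuousMap.Homotopic (j.comp r) (ContinuousMap.id _) :=
    ContinuousMap.Homotopic.symm
      ⟨⟨⟨fun p => ⟨pushTo i c p.1 p.2.1, hpush p.1 p.2.1 p.2.2⟩,
        (hcont.comp (continuous_fst.prodMk
          (continuous_subtype_val.comp continuous_snd))).subtype_mk _⟩,
        fun x => Subtype.ext (pushTo_zero _), fun x => rfl⟩⟩
  exact ContinuousMap.HomotopyEquiv.contractibleSpace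
    ⟨r, j, hjr, hrj ▸ ContinuousMap.Homotopic.refl _⟩

end Cone

/-! ### Mapping cylinders inside the complex of colorings. -/

section Colorings

variable {V W : Type*}

/-- The families of nonempty sets that assign pairwise disjoint subsets of `N` to the elements of
`M`, and `{β v}` to every other `v`. -/
def colorings (M : Finset V) (N : Finset W) (β : V → W) : Set (V → Finset W) :=
  {s | (∀ v, (s v).Nonempty) ∧ (∀ v ∉ M, s v = {β v}) ∧ (∀ v ∈ M, s v ⊆ N) ∧
    ∀ v ∈ M, ∀ w ∈ M, v ≠ w → Disjoint (s v) (s w)}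

variable {M : Finset V} {N : Finset W} {β : V → W}

theorem isFaceClosed_colorings : IsFaceClosed (colorings M N β) := by
  rintro s ⟨h1, h2, h3, h4⟩ s' hs hne
  refine ⟨hne, fun v hv => ?_, fun v hv => (hs v).trans (h3 v hv), fun v hv w hw hvw =>
    (h4 v hv w hw hvw).mono (hs v) (hs w)⟩
  exact (Finset.subset_singleton_iff.1 ((hs v).trans (h2 v hv).le)).resolve_left (hne v).ne_empty

variable [DecidableEq W] {c : W}

theorem notMem_of_mem_colorings_erase {s : V → Finset W} (hs : s ∈ colorings M (N.erase c) β)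
    {v : V} (hv : v ∈ M) : c ∉ s v := fun h => by simpa using hs.2.2.1 v hv h

variable [DecidableEq V] {i : V} {Q C : Set (V → Finset W)}

theorem mem_or_mem_of_mem_cylinder
    (hC : C ⊆ colorings (M.erase i) (N.erase c) (Function.update β i c)) {s : V → Finset W}
    (hs : s ∈ cylinder i c Q C) : s ∈ Q ∨ c ∈ s i := by
  rcases hs with hs | ⟨hc, _⟩ | hs
  · exact Or.inl hs
  · exact Or.inr hc
  · refine Or.inr ?_
    rw [(hC hs).2.1 i (by simp)]
    simp

theorem update_mem_colorings (hi : i ∈ M) {s : V → Finset W}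
    (hs : s ∈ colorings M (N.erase c) β) :
    Function.update s i {c} ∈ colorings (M.erase i) (N.erase c) (Function.update β i c) := by
  obtain ⟨h1, h2, h3, h4⟩ := hs
  refine ⟨fun v => ?_, fun v hv => ?_, fun v hv => ?_, fun v hv w hw hvw => ?_⟩
  · by_cases h : v = i
    · subst h; simp
    · simpa [h] using h1 v
  · by_cases h : v = i
    · subst h; simp
    · simpa [h] using h2 v (by simpa [h] using hv)
  · obtain ⟨h, hv⟩ := Finset.mem_erase.1 hv
    simpa [h] using h3 v hv
  · obtain ⟨h, hv⟩ := Finset.mem_erase.1 hv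
    obtain ⟨h', hw⟩ := Finset.mem_erase.1 hw
    simpa [h, h'] using h4 v hv w hw hvw

theorem cylinder_subset_colorings (hi : i ∈ M) (hc : c ∈ N)
    (hQ : Q ⊆ colorings M (N.erase c) β)
    (hC : C ⊆ colorings (M.erase i) (N.erase c) (Function.update β i c)) :
    cylinder i c Q C ⊆ colorings M N β := by
  rintro s (hs | ⟨hcs, hs⟩ | hs)
  · obtain ⟨h1, h2, h3, h4⟩ := hQ hs
    exact ⟨h1, h2, fun v hv => (h3 v hv).trans (Finset.erase_subset _ _), h4⟩
  · have hn := fun v => notMem_of_mem_colorings_erase (hQ hs) (v := v)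
    obtain ⟨h1, h2, h3, h4⟩ := hQ hs
    have hd (w) (hw : w ∈ M) (hwi : w ≠ i) : Disjoint (s i) (s w) := by
      have h := h4 i hi w hw hwi.symm
      have hcw := hn w hw
      simp only [Function.update_self, ne_eq, hwi, not_false_eq_true,
        Function.update_of_ne] at h hcw
      rw [← Finset.insert_erase hcs, Finset.disjoint_insert_left]
      exact ⟨hcw, h⟩
    refine ⟨fun v => ?_, fun v hv => ?_, fun v hv => ?_, fun v hv w hw hvw => ?_⟩
    · by_cases h : v = i
      · subst h; exact ⟨c, hcs⟩
      · simpa [h] using h1 v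
    · have h : v ≠ i := fun h => hv (h ▸ hi)
      simpa [h] using h2 v hv
    · by_cases h : v = i
      · subst h
        have := h3 v hv
        simp only [Function.update_self] at this
        rw [← Finset.insert_erase hcs]
        exact Finset.insert_subset hc (this.trans (Finset.erase_subset _ _))
      · have := h3 v hv
        simp only [ne_eq, h, not_false_eq_true, Function.update_of_ne] at this
        exact this.trans (Finset.erase_subset _ _)
    · by_cases h : v = i
      · subst h; exact hd w hw hvw.symm
      · by_cases h' : w = i
        · subst h'; exact (hd v hv h).symm
        · simpa [h, h'] using h4 v hv w hw hvw
  · obtain ⟨h1, h2, h3, h4⟩ := hC hs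
    have hsi : s i = {c} := by simpa using h2 i (by simp)
    have hd (w) (hw : w ∈ M) (hwi : w ≠ i) : Disjoint (s i) (s w) := by
      rw [hsi, Finset.disjoint_singleton_left]
      intro h
      simpa using h3 w (by simp [hw, hwi]) h
    refine ⟨h1, fun v hv => ?_, fun v hv => ?_, fun v hv w hw hvw => ?_⟩
    · have h : v ≠ i := fun h => hv (h ▸ hi)
      simpa [h] using h2 v (by simp [hv])
    · by_cases h : v = i
      · subst h; simpa [hsi] using hc
      · exact (h3 v (by simp [h, hv])).trans (Finset.erase_subset _ _)
    · by_cases h : v = i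
      · subst h; exact hd w hw hvw.symm
      · by_cases h' : w = i
        · subst h'; exact (hd v hv h).symm
        · exact h4 v (by simp [h, hv]) w (by simp [h', hw]) hvw

/-- The coloring does not use all the colors. -/
def OmitsColor (M : Finset V) (N : Finset W) (s : V → Finset W) : Prop :=
  ∃ a ∈ N, ∀ v ∈ M, a ∉ s v

/-- By disjointness, no other vertex uses the colors that `i` gives up. -/
theorem update_omitsColor (hi : i ∈ M) {s : V → Finset W}
    (hs : s ∈ colorings M (N.erase c) β) :
    OmitsColor (M.erase i) (N.erase c) (Function.update s i {c}) := by
  obtain ⟨a, ha⟩ := hs.1 i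
  refine ⟨a, hs.2.2.1 i hi ha, fun v hv hav => ?_⟩
  obtain ⟨h, hv⟩ := Finset.mem_erase.1 hv
  simp only [ne_eq, h, not_false_eq_true, Function.update_of_ne] at hav
  exact Finset.disjoint_left.1 (hs.2.2.2 v hv i hi h) hav ha

theorem isFaceClosed_cylinder (hi : i ∈ M) (hQ : Q ⊆ colorings M (N.erase c) β)
    (hQ' : IsFaceClosed Q) (hC' : IsFaceClosed C)
    (hC : ∀ s ∈ colorings (M.erase i) (N.erase c) (Function.update β i c),
      OmitsColor (M.erase i) (N.erase c) s → s ∈ C) : IsFaceClosed (cylinder i c Q C) := by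
  rintro s (hs | ⟨hcs, hs⟩ | hs) s' hle hne
  · exact Or.inl (hQ' s hs s' hle hne)
  · have hle' : Function.update s' i ((s' i).erase c) ≤ Function.update s i ((s i).erase c) := by
      intro v
      by_cases h : v = i
      · subst h; simpa using Finset.erase_subset_erase c (hle v)
      · simpa [h] using hle v
    by_cases he : ((s' i).erase c).Nonempty
    · have hQs' := hQ' _ hs _ hle' fun v => by
        by_cases h : v = i
        · subst h; simpa using he
        · simpa [h] using hne v
      by_cases hc' : c ∈ s' i
      · exact Or.inr (Or.inl ⟨hc', hQs'⟩)
      · left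
        simpa [Finset.erase_eq_of_notMem hc'] using hQs'
    -- Only `c` survives at `i`: this is a face at the target end of the cylinder. It lies in `C`
    -- because the other colors of `s i` have become free.
    · have hs' : s' i = {c} := by
        rw [Finset.not_nonempty_iff_eq_empty, Finset.erase_eq_empty_iff] at he
        exact he.resolve_left (hne i).ne_empty
      refine Or.inr (Or.inr (hC' _ (hC _ (update_mem_colorings hi (hQ hs))
        (update_omitsColor hi (hQ hs))) s' (fun v => ?_) hne))
      by_cases h : v = i
      · subst h; simp [hs']
      · simpa [h] using hle v
  · exact Or.inr (Or.inr (hC' s hs s' hle hne))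

/-- A cell of the `i`-th cylinder outside `Q` has `c` in its `i`-th set. Disjointness forbids `c` at
both `i` and `j`, and `Q`, `Q'` avoid `c`. -/
theorem cylinder_inter_cylinder {j : V} {Q' C' : Set (V → Finset W)} (hi : i ∈ M) (hj : j ∈ M)
    (hij : i ≠ j) (hc : c ∈ N) (hQ : Q ⊆ colorings M (N.erase c) β)
    (hQ' : Q' ⊆ colorings M (N.erase c) β)
    (hC : C ⊆ colorings (M.erase i) (N.erase c) (Function.update β i c))
    (hC' : C' ⊆ colorings (M.erase j) (N.erase c) (Function.update β j c)) :
    cylinder i c Q C ∩ cylinder j c Q' C' = Q ∩ Q' := by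
  refine Set.Subset.antisymm ?_ fun s hs => ⟨Or.inl hs.1, Or.inl hs.2⟩
  rintro s ⟨h1, h2⟩
  have hs := cylinder_subset_colorings hi hc hQ hC h1
  rcases mem_or_mem_of_mem_cylinder hC h1 with h3 | h3
  · rcases mem_or_mem_of_mem_cylinder hC' h2 with h4 | h4
    · exact ⟨h3, h4⟩
    · exact (notMem_of_mem_colorings_erase (hQ h3) hj h4).elim
  · rcases mem_or_mem_of_mem_cylinder hC' h2 with h4 | h4
    · exact (notMem_of_mem_colorings_erase (hQ' h4) hi h3).elim
    · exact (Finset.disjoint_left.1 (hs.2.2.2 i hi j hj hij) h3 h4).elim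

end Colorings

/-! ### Existence of cores. -/

section Colorings

variable {V W : Type*}

theorem isFaceClosed_vertex (β : V → W) : IsFaceClosed {fun v => ({β v} : Finset W)} := by
  rintro s rfl s' hs hne
  ext1 v
  exact (Finset.subset_singleton_iff.1 (hs v)).resolve_left (hne v).ne_empty

theorem mem_colorings_of_injOn {M : Finset V} {N : Finset W} {β f : V → W} (hf : Set.InjOn f M)
    (hN : ∀ v ∈ M, f v ∈ N) (hβ : ∀ v ∉ M, f v = β v) :
    (fun v => {f v}) ∈ colorings M N β := by
  refine ⟨fun v => by simp, fun v hv => by simp [hβ v hv], fun v hv => by simpa using hN v hv,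
    fun v hv w hw hvw => ?_⟩
  simpa using fun h => hvw (hf hv hw h)

variable [DecidableEq W]

theorem not_omitsColor_of_card_le {M : Finset V} {N : Finset W} {β : V → W} (h : N.card ≤ M.card)
    {s : V → Finset W} (hs : s ∈ colorings M N β) : ¬ OmitsColor M N s := by
  rintro ⟨a, ha, hna⟩
  have h1 : M.card ≤ (M.biUnion s).card :=
    Finset.card_le_card_biUnion (fun v hv w hw hvw => hs.2.2.2 v hv w hw hvw) fun v _ => hs.1 v
  have h2 : M.biUnion s ⊆ N.erase a := fun b hb => by
    obtain ⟨v, hv, hb⟩ := Finset.mem_biUnion.1 hb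
    refine Finset.mem_erase.2 ⟨?_, hs.2.2.1 v hv hb⟩
    rintro rfl
    exact hna v hv hb
  have h3 := Finset.card_le_card h2
  have h4 := Finset.card_erase_lt_of_mem ha
  omega

theorem posSupport_single [Fintype W] (β : V → W) :
    posSupport (fun v => Pi.single (β v) (1 : ℝ)) = fun v => {β v} := by
  ext v a
  by_cases ha : a = β v
  · subst ha; simp
  · simp [ha]

theorem realization_vertex [Fintype W] (β : V → W) :
    realization {fun v => {β v}} = {fun v => Pi.single (β v) (1 : ℝ)} := by
  ext x
  refine ⟨fun hx => ?_, ?_⟩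
  · ext1 v
    refine eq_single_of_mem_stdSimplex (hx.1 v) fun a ha => ?_
    have : a ∈ posSupport x v := mem_posSupport.2 ha
    rw [show posSupport x = _ from hx.2] at this
    simpa using this
  · rintro rfl
    exact ⟨fun v => single_mem_stdSimplex ℝ (β v), posSupport_single β⟩

theorem contractibleSpace_realization_vertex [Fintype W] (β : V → W) :
    ContractibleSpace (realization {fun v => ({β v} : Finset W)}) := by
  rw [realization_vertex]
  infer_instance

/-- A contractible subcomplex of the complex of colorings whose complement consists of
surjective colorings. -/
structure IsCore [Fintype W] (M : Finset V) (N : Finset W) (β : V → W) (Y : Set (V → Finset W)) :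
    Prop where
  subset : Y ⊆ colorings M N β
  isFaceClosed : IsFaceClosed Y
  contractible : ContractibleSpace (realization Y)
  mem_of_omitsColor : ∀ s ∈ colorings M N β, OmitsColor M N s → s ∈ Y
  exists_notMem : 2 ≤ M.card → ∃ s ∈ colorings M N β, s ∉ Y

theorem isCore_empty [Fintype W] (N : Finset W) (β : V → W) :
    IsCore ∅ N β {fun v => {β v}} := by
  refine ⟨?_, isFaceClosed_vertex β, contractibleSpace_realization_vertex β, fun s hs _ => ?_,
    fun h => by simp at h⟩
  · rintro _ rfl
    exact mem_colorings_of_injOn (by simp) (by simp) (by simp)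
  · ext1 v
    exact hs.2.1 v (by simp)

variable [DecidableEq V]

/-- All colorings are bijections on `M` here, none omits a color, and a single vertex serves as the
core. Swapping two values gives a cell outside it. -/
theorem exists_isCore_of_card_eq [Fintype W] {M : Finset V} {N : Finset W} (β : V → W)
    (h : M.card = N.card) : ∃ Y, IsCore M N β Y := by
  classical
  let e : M ≃ N := Fintype.equivOfCardEq (by simpa using h)
  let f : V → W := fun v => if hv : v ∈ M then (e ⟨v, hv⟩).1 else β v
  have hf (v) (hv : v ∈ M) : f v = e ⟨v, hv⟩ := by simp [f, hv]
  have hinj : Set.InjOn f M := fun v hv w hw hvw => by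
    rw [hf v hv, hf w hw] at hvw
    simpa using hvw
  have hN (v) (hv : v ∈ M) : f v ∈ N := by simp [hf v hv]
  have hβ (v) (hv : v ∉ M) : f v = β v := by simp [f, hv]
  refine ⟨{fun v => {f v}}, ?_, isFaceClosed_vertex f, contractibleSpace_realization_vertex f,
    fun s hs ho => (not_omitsColor_of_card_le h.ge hs ho).elim, fun h2 => ?_⟩
  · rintro _ rfl
    exact mem_colorings_of_injOn hinj hN hβ
  · obtain ⟨i, hi, j, hj, hij⟩ := Finset.one_lt_card.1 h2
    have hsw (v) : Equiv.swap i j v ∈ M ↔ v ∈ M := by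
      rcases eq_or_ne v i with rfl | hvi
      · simp [hi, hj]
      rcases eq_or_ne v j with rfl | hvj
      · simp [hi, hj]
      · rw [Equiv.swap_apply_of_ne_of_ne hvi hvj]
    refine ⟨fun v => {f (Equiv.swap i j v)}, mem_colorings_of_injOn (fun v hv w hw hvw => ?_)
      (fun v hv => hN _ ((hsw v).2 hv)) (fun v hv => ?_), fun hmem => ?_⟩
    · exact (Equiv.swap i j).injective (hinj ((hsw v).2 hv) ((hsw w).2 hw) hvw)
    · rw [Equiv.swap_apply_of_ne_of_ne, hβ v hv]
      · rintro rfl; exact hv hi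
      · rintro rfl; exact hv hj
    · have := congr_fun hmem i
      simp only [Equiv.swap_apply_left, Finset.singleton_inj] at this
      exact hij (hinj hi hj this.symm)

/-- The cylinder at `i₀` stands on all of `A`, to capture every coloring without `c`. The others
stand only on `Y`, so that each attachment is along the contractible `Y`. -/
theorem isCore_union_cylinder [Finite V] [Fintype W] {M : Finset V} {N : Finset W} {β : V → W}
    {c : W} (hc : c ∈ N) {i₀ : V} (hi₀ : i₀ ∈ M) {Y : Set (V → Finset W)}
    (hY : IsCore M (N.erase c) β Y) {C : V → Set (V → Finset W)}
    (hC : ∀ i, IsCore (M.erase i) (N.erase c) (Function.update β i c) (C i)) :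
    IsCore M N β (cylinder i₀ c (colorings M (N.erase c) β) (C i₀) ∪
      ⋃ i ∈ M.erase i₀, cylinder i c Y (C i)) := by
  set A := colorings M (N.erase c) β
  have hcyl (i) (hi : i ∈ M) {Q} (hQ : Q ⊆ A) :
      ContractibleSpace (realization (cylinder i c Q (C i))) := by
    refine contractibleSpace_realization_cylinder
      (fun s hs => notMem_of_mem_colorings_erase (hQ hs) hi)
      (fun s hs => ?_) (fun s hs => ?_) (hC i).contractible
    · simpa using ((hC i).subset hs).2.1 i (by simp)
    · exact (hC i).mem_of_omitsColor _ (update_mem_colorings hi (hQ hs))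
        (update_omitsColor hi (hQ hs))
  have hface (i) (hi : i ∈ M) {Q} (hQ : Q ⊆ A) (hQ' : IsFaceClosed Q) :
      IsFaceClosed (cylinder i c Q (C i)) :=
    isFaceClosed_cylinder hi hQ hQ' (hC i).isFaceClosed (hC i).mem_of_omitsColor
  have hsub (i) (hi : i ∈ M) {Q} (hQ : Q ⊆ A) : cylinder i c Q (C i) ⊆ colorings M N β :=
    cylinder_subset_colorings hi hc hQ (hC i).subset
  have key (J : Finset V) (hJ : J ⊆ M.erase i₀) :
      IsFaceClosed (cylinder i₀ c A (C i₀) ∪ ⋃ i ∈ J, cylinder i c Y (C i)) ∧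
      ContractibleSpace
        (realization (cylinder i₀ c A (C i₀) ∪ ⋃ i ∈ J, cylinder i c Y (C i))) := by
    induction J using Finset.induction_on with
    | empty =>
      have : cylinder i₀ c A (C i₀) ∪ ⋃ i ∈ (∅ : Finset V), cylinder i c Y (C i) =
          cylinder i₀ c A (C i₀) := by simp
      rw [this]
      exact ⟨hface i₀ hi₀ subset_rfl isFaceClosed_colorings, hcyl i₀ hi₀ subset_rfl⟩
    | insert j J hj ih =>
      obtain ⟨ih1, ih2⟩ := ih ((Finset.subset_insert j J).trans hJ)
      obtain ⟨hji₀, hjM⟩ := Finset.mem_erase.1 (hJ (Finset.mem_insert_self j J))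
      rw [Finset.set_biUnion_insert, Set.union_comm (cylinder j c Y (C j)), ← Set.union_assoc]
      have hjf := hface j hjM hY.subset hY.isFaceClosed
      refine ⟨fun s hs s' h hne => hs.imp (fun hs => ih1 s hs s' h hne)
        fun hs => hjf s hs s' h hne,
        contractibleSpace_realization_union ih1 hjf ih2 (hcyl j hjM hY.subset) ?_⟩
      have : (cylinder i₀ c A (C i₀) ∪ ⋃ i ∈ J, cylinder i c Y (C i)) ∩ cylinder j c Y (C j) = Y := by
        rw [Set.union_inter_distrib_right, cylinder_inter_cylinder hi₀ hjM hji₀.symm hc subset_rfl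
          hY.subset (hC i₀).subset (hC j).subset, Set.inter_eq_right.2 hY.subset, Set.iUnion₂_inter,
          Set.union_eq_left]
        refine Set.iUnion₂_subset fun i hi => ?_
        have hiM := (Finset.mem_erase.1 (hJ (Finset.mem_insert_of_mem hi))).2
        rw [cylinder_inter_cylinder hiM hjM (fun h => hj (h ▸ hi)) hc hY.subset hY.subset
          (hC i).subset (hC j).subset, Set.inter_self]
      rw [this]
      exact hY.contractible
  refine ⟨?_, (key _ subset_rfl).1, (key _ subset_rfl).2, fun s hs ho => ?_, fun h2 => ?_⟩
  · refine Set.union_subset (hsub i₀ hi₀ subset_rfl) (Set.iUnion₂_subset fun i hi => ?_)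
    exact hsub i (Finset.mem_erase.1 hi).2 hY.subset
  · obtain ⟨a, ha, hna⟩ := ho
    -- If `i` uses `c`, then deleting `c` from `s i` leaves a coloring that still omits `a ≠ c`,
    -- hence a cell of `Y`. If nothing is left at `i`, then `s` itself is in `C i`.
    by_cases hcs : ∃ i ∈ M, c ∈ s i
    · obtain ⟨i, hi, hci⟩ := hcs
      have hac : a ≠ c := by rintro rfl; exact hna i hi hci
      suffices h : s ∈ cylinder i c Y (C i) by
        by_cases hii : i = i₀
        · subst hii
          exact Or.inl (h.imp (fun h => hY.subset h) (Or.imp_left fun h => ⟨h.1, hY.subset h.2⟩))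
        · exact Or.inr (Set.mem_iUnion₂.2 ⟨i, by simp [hii, hi], h⟩)
      have hcv (v) (hv : v ∈ M) (hvi : v ≠ i) : c ∉ s v := fun h =>
        Finset.disjoint_left.1 (hs.2.2.2 v hv i hi hvi) h hci
      obtain ⟨h1, h2, h3, h4⟩ := hs
      by_cases he : ((s i).erase c).Nonempty
      · refine Or.inr (Or.inl ⟨hci, hY.mem_of_omitsColor _ ⟨fun v => ?_, fun v hv => ?_,
          fun v hv => ?_, fun v hv w hw hvw => ?_⟩ ⟨a, by simp [ha, hac], fun v hv => ?_⟩⟩)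
        · by_cases h : v = i
          · subst h; simpa using he
          · simpa [h] using h1 v
        · have h : v ≠ i := fun h => hv (h ▸ hi)
          simpa [h] using h2 v hv
        · by_cases h : v = i
          · subst h; simpa using Finset.erase_subset_erase c (h3 v hv)
          · simpa [h, Finset.subset_erase] using ⟨h3 v hv, hcv v hv h⟩
        · refine (h4 v hv w hw hvw).mono ?_ ?_
          · by_cases h : v = i
            · subst h; simpa using Finset.erase_subset c _
            · simp [h]
          · by_cases h : w = i
            · subst h; simpa using Finset.erase_subset c _
            · simp [h]
        · by_cases h : v = i
          · subst h; simpa [hac] using hna v hv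
          · simpa [h] using hna v hv
      · have hsi : s i = {c} := by
          rw [Finset.not_nonempty_iff_eq_empty, Finset.erase_eq_empty_iff] at he
          exact he.resolve_left (h1 i).ne_empty
        refine Or.inr (Or.inr ((hC i).mem_of_omitsColor _ ⟨h1, fun v hv => ?_,
          fun v hv => ?_, fun v hv w hw hvw => ?_⟩ ⟨a, by simp [ha, hac], fun v hv => ?_⟩))
        · by_cases h : v = i
          · subst h; simpa using hsi
          · simpa [h] using h2 v (by simpa [h] using hv)
        · obtain ⟨h, hv⟩ := Finset.mem_erase.1 hv
          exact Finset.subset_erase.2 ⟨h3 v hv, hcv v hv h⟩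
        · exact h4 v (Finset.mem_of_mem_erase hv) w (Finset.mem_of_mem_erase hw) hvw
        · exact hna v (Finset.mem_of_mem_erase hv)
    · push Not at hcs
      exact Or.inl (Or.inl ⟨hs.1, hs.2.1,
        fun v hv => Finset.subset_erase.2 ⟨hs.2.2.1 v hv, hcs v hv⟩, hs.2.2.2⟩)
  · obtain ⟨s, hs, hsY⟩ := hY.exists_notMem h2
    -- Add `c` at a vertex `i ≠ i₀` to a cell outside `Y`. At `i₀` the result would lie in the
    -- cylinder over `A`; this is why two vertices are needed.
    obtain ⟨i, hi, hii⟩ := Finset.exists_mem_ne h2 i₀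
    have hci := notMem_of_mem_colorings_erase hs hi
    let s' := Function.update s i (insert c (s i))
    have hs'i : s' i = insert c (s i) := by simp [s']
    have hs' : s' ∈ cylinder i c A (C i) :=
      Or.inr (Or.inl ⟨by simp [s'], by simpa [s', Finset.erase_insert hci] using hs⟩)
    have hs'N := hsub i hi subset_rfl hs'
    have hs'A : s' ∉ A := fun h => notMem_of_mem_colorings_erase h hi (by simp [s'])
    have hcv (v) (hv : v ∈ M) (hvi : v ≠ i) : c ∉ s' v := fun h =>
      Finset.disjoint_left.1 (hs'N.2.2.2 v hv i hi hvi) h (by simp [s'])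
    refine ⟨s', hs'N, ?_⟩
    rintro (h | h)
    · rcases mem_or_mem_of_mem_cylinder (hC i₀).subset h with h | h
      · exact hs'A h
      · exact hcv i₀ hi₀ hii.symm h
    · obtain ⟨j, hj, h⟩ := Set.mem_iUnion₂.1 h
      have hjM := (Finset.mem_erase.1 hj).2
      by_cases hji : j = i
      · subst hji
        rcases h with h | ⟨_, h⟩ | h
        · exact hs'A (hY.subset h)
        · exact hsY (by simpa [s', Finset.erase_insert hci] using h)
        · have hsi : s' j = {c} := by simpa using ((hC j).subset h).2.1 j (by simp)
          obtain ⟨a, ha⟩ := hs.1 j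
          have : a ∈ s' j := by simp [s', ha]
          rw [hsi, Finset.mem_singleton] at this
          exact hci (this ▸ ha)
      · rcases mem_or_mem_of_mem_cylinder (hC j).subset h with h | h
        · exact hs'A (hY.subset h)
        · exact hcv j hjM hji h

theorem exists_isCore [Finite V] [Fintype W] (M : Finset V) (N : Finset W) (β : V → W)
    (h : M.card ≤ N.card) : ∃ Y, IsCore M N β Y := by
  induction hn : N.card generalizing M N β with
  | zero => exact exists_isCore_of_card_eq β (by omega)
  | succ n ih =>
    rcases M.eq_empty_or_nonempty with rfl | ⟨i₀, hi₀⟩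
    · exact ⟨_, isCore_empty N β⟩
    -- Equality must be split off: without `c` there would be too few colors for `M`.
    rcases h.eq_or_lt with h | h
    · exact exists_isCore_of_card_eq β h
    obtain ⟨c, hc⟩ : N.Nonempty := Finset.card_pos.1 (by omega)
    have hN : (N.erase c).card = n := by rw [Finset.card_erase_of_mem hc]; omega
    obtain ⟨Y, hY⟩ := ih M (N.erase c) β (by omega) hN
    have hM (i) : (M.erase i).card ≤ (N.erase c).card :=
      Finset.card_erase_le.trans (by omega)
    choose C hC using fun i => ih (M.erase i) (N.erase c) (Function.update β i c) (hM i) hN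
    exact ⟨_, isCore_union_cylinder hc hi₀ hY hC⟩

end Colorings

/-! ### Wedges and the collapse onto a wedge of spheres. -/

section Wedge

variable {ι : Type*} [DecidableEq ι] {X : ι → Type*} (x : ∀ i, X i)

/-- The wedge embeds into the product. -/
def Wedge.toPi : Wedge x → ∀ i, X i :=
  Quot.lift (Sum.elim (fun _ => x) fun p => Function.update x p.1 p.2) (by
    rintro _ _ ⟨rfl, i, rfl⟩
    simp)

theorem Wedge.toPi_injective : Function.Injective (Wedge.toPi x) := by
  have base (i : ι) : (Quot.mk _ (Sum.inr ⟨i, x i⟩) : Wedge x) = Quot.mk _ (Sum.inl ()) :=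
    (Quot.sound ⟨rfl, i, rfl⟩).symm
  have key (i : ι) (y : X i) (h : x = Function.update x i y) :
      (Quot.mk _ (Sum.inr ⟨i, y⟩) : Wedge x) = Quot.mk _ (Sum.inl ()) := by
    have := congr_fun h i
    rw [Function.update_self] at this
    rw [← this, base]
  rintro ⟨⟨⟩ | ⟨i, y⟩⟩ ⟨⟨⟩ | ⟨j, z⟩⟩ h
  · rfl
  · exact (key j z h).symm
  · exact key i y h.symm
  · change Function.update x i y = Function.update x j z at h
    by_cases hij : i = j
    · subst hij
      rw [Function.update_injective x i h]
    · have h1 := congr_fun h i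
      have h2 := congr_fun h j
      rw [Function.update_self, Function.update_of_ne hij] at h1
      rw [Function.update_self, Function.update_of_ne (Ne.symm hij)] at h2
      rw [h1, ← h2, base, base]

theorem Wedge.continuous_toPi [∀ i, TopologicalSpace (X i)] : Continuous (Wedge.toPi x) := by
  refine continuous_quot_lift _ ?_
  refine continuous_const.sumElim (continuous_sigma fun i => ?_)
  exact continuous_const.update i continuous_id

instance [∀ i, TopologicalSpace (X i)] [∀ i, T2Space (X i)] : T2Space (Wedge x) :=
  T2Space.of_injective_continuous (Wedge.toPi_injective x) (Wedge.continuous_toPi x)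

end Wedge

/-- Stereographic projection, after identifying `F` with the hyperplane orthogonal to the base
point. -/
theorem exists_onePoint_homeomorph_stdSphere (d : ℕ) {F : Type*} [NormedAddCommGroup F]
    [NormedSpace ℝ F] [FiniteDimensional ℝ F] (hF : Module.finrank ℝ F = d) :
    ∃ e : OnePoint F ≃ₜ StdSphere d, e OnePoint.infty = StdSphere.base d := by
  let v : EuclideanSpace ℝ (Fin (d + 1)) := EuclideanSpace.single 0 1
  have hv : ‖v‖ = 1 := by simp [v]
  have hv0 : v ≠ 0 := fun h => by simp [h] at hv
  have : Fact (Module.finrank ℝ (EuclideanSpace ℝ (Fin (d + 1))) = d + 1) := ⟨by simp⟩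
  have hd : Module.finrank ℝ F = Module.finrank ℝ (Submodule.span ℝ {v})ᗮ :=
    hF.trans (Submodule.finrank_orthogonal_span_singleton hv0).symm
  let e : F ≃ₜ (Submodule.span ℝ {v})ᗮ :=
    (ContinuousLinearEquiv.ofFinrankEq hd).toHomeomorph
  refine ⟨e.onePointCongr.trans (onePointHyperplaneHomeoUnitSphere hv), ?_⟩
  have h1 : e.onePointCongr OnePoint.infty = OnePoint.infty := rfl
  rw [Homeomorph.trans_apply, h1]
  exact OnePoint.equivOfIsEmbeddingOfRangeEq_apply_infty _ _ _ _

open Classical in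
/-- Send the complement of `U` to the point at infinity. -/
noncomputable def collapseCompl {X F : Type*} {U : Set X} (h : U → F) (x : X) : OnePoint F :=
  if hx : x ∈ U then (h ⟨x, hx⟩ : F) else OnePoint.infty

/-- The complement of a neighborhood of infinity pulls back to a compact set, which is closed
because `X` is Hausdorff. -/
theorem continuous_collapseCompl {X F : Type*} [TopologicalSpace X] [T2Space X]
    [TopologicalSpace F] {U : Set X} (hU : IsOpen U) (h : U ≃ₜ F) :
    Continuous (collapseCompl h) := by
  have himg (s : Set F) : Subtype.val '' (h ⁻¹' s) = {x : X | ∃ hx : x ∈ U, h ⟨x, hx⟩ ∈ s} := by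
    ext x
    simp
  refine continuous_def.2 fun s hs => ?_
  by_cases hi : OnePoint.infty ∈ s
  · have hK := (h.isCompact_preimage.2 ((OnePoint.isOpen_iff_of_mem' hi).1 hs).1).image
      continuous_subtype_val
    convert hK.isClosed.isOpen_compl using 1
    rw [himg]
    ext x
    by_cases hx : x ∈ U <;> simp [collapseCompl, hx, hi]
  · have hK := hU.isOpenMap_subtype_val _
      (((OnePoint.isOpen_iff_of_notMem hi).1 hs).preimage h.continuous)
    convert hK using 1
    rw [himg]
    ext x
    by_cases hx : x ∈ U <;> simp [collapseCompl, hx, hi]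

theorem nonempty_homotopyEquiv_wedge {E : Type*} [TopologicalSpace E] [T2Space E] {X Y : Set E}
    (hX : IsCompact X) (hYX : Y ⊆ X) (h : HasNullDeformation X Y) {k d : ℕ} (U : Fin k → Set X)
    (hU : ∀ i, IsOpen (U i)) (hd : ∀ i j x, x ∈ U i → x ∈ U j → i = j)
    (hUY : ∀ x : X, x.1 ∈ Y ↔ ∀ i, x ∉ U i) {F : Fin k → Type*} [∀ i, NormedAddCommGroup (F i)]
    [∀ i, NormedSpace ℝ (F i)] [∀ i, FiniteDimensional ℝ (F i)]
    (hF : ∀ i, Module.finrank ℝ (F i) = d) (φ : ∀ i, U i ≃ₜ F i) :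
    Nonempty (X ≃ₕ SphereWedge k d) := by
  classical
  choose e he using fun i => exists_onePoint_homeomorph_stdSphere d (hF i)
  let q (i : Fin k) (x : X) : StdSphere d := e i (collapseCompl (φ i) x)
  have hqc (i) : Continuous (q i) := (e i).continuous.comp (continuous_collapseCompl (hU i) (φ i))
  have hq0 (i x) (hx : x ∉ U i) : q i x = StdSphere.base d := by simp [q, collapseCompl, hx, he]
  have hq1 (i x) (hx : x ∈ U i) : q i x ≠ StdSphere.base d := by
    rw [← he i]
    simp [q, collapseCompl, hx]
  have hq2 (i x x') (hx : x ∈ U i) (hx' : x' ∈ U i) (hxx : q i x = q i x') : x = x' := by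
    simpa [q, collapseCompl, hx, hx'] using hxx
  have hq3 (i y) (hy : y ≠ StdSphere.base d) : ∃ x, q i x = y := by
    have hne : (e i).symm y ≠ OnePoint.infty := fun h0 => hy (by rw [← he i, ← h0]; simp)
    obtain ⟨z, hz⟩ := OnePoint.ne_infty_iff_exists.1 hne
    refine ⟨((φ i).symm z).1, ?_⟩
    simp [q, collapseCompl, hz]
  let Q (x : X) : SphereWedge k d :=
    if hx : ∃ i, x ∈ U i then Quot.mk _ (Sum.inr ⟨hx.choose, q hx.choose x⟩)
    else Quot.mk _ (Sum.inl ())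
  have hQY (x : X) (hx : ∀ i, x ∉ U i) : Q x = Quot.mk _ (Sum.inl ()) := by
    simp [Q, hx]
  have hQU (i) (x : X) (hx : x ∈ U i) : Q x = Quot.mk _ (Sum.inr ⟨i, q i x⟩) := by
    have hex : ∃ i, x ∈ U i := ⟨i, hx⟩
    have : hex.choose = i := hd _ _ x hex.choose_spec hx
    simp only [Q, hex, dif_pos]
    rw [this]
  let b : ∀ _ : Fin k, StdSphere d := fun _ => StdSphere.base d
  have hpi (x : X) : Wedge.toPi b (Q x) = fun i => q i x := by
    ext1 j
    by_cases hx : ∃ i, x ∈ U i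
    · obtain ⟨i, hx⟩ := hx
      rw [hQU i x hx]
      change Function.update b i (q i x) j = q j x
      by_cases hji : j = i
      · subst hji; simp
      · rw [Function.update_of_ne hji, hq0 j x fun hj => hji (hd j i x hj hx)]
    · push Not at hx
      rw [hQY x hx, hq0 j x (hx j)]
      rfl
  -- The wedge is compact and embeds in the product of the spheres, so continuity is checked one
  -- sphere at a time.
  have hQc : Continuous Q := by
    have hemb := (Wedge.continuous_toPi b).isClosedEmbedding (Wedge.toPi_injective b)
    rw [hemb.isInducing.continuous_iff]
    exact (continuous_pi hqc).congr fun x => (hpi x).symm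
  have hYU (x : X) : x.1 ∈ Y ∨ ∃ i, x ∈ U i := by
    rw [hUY, ← not_exists]
    exact (em _).symm
  refine nonempty_homotopyEquiv_of_collapse hX h ⟨Q, hQc⟩ ?_ fun x x' => ?_
  · obtain ⟨-, v, hv, -⟩ := h
    have hb : Q ⟨v, hYX hv⟩ = Quot.mk _ (Sum.inl ()) := hQY _ ((hUY _).1 hv)
    rintro ⟨⟨⟩ | ⟨i, y⟩⟩
    · exact ⟨_, hb⟩
    · by_cases hy : y = StdSphere.base d
      · refine ⟨⟨v, hYX hv⟩, hb.trans ?_⟩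
        rw [hy]
        exact Quot.sound ⟨rfl, i, rfl⟩
      · obtain ⟨x, rfl⟩ := hq3 i y hy
        exact ⟨x, hQU i x (by_contra fun hx => hy (hq0 i x hx))⟩
  · simp only [ContinuousMap.coe_mk]
    rw [← (Wedge.toPi_injective b).eq_iff, hpi, hpi]
    refine ⟨fun hxx => ?_, ?_⟩
    · by_cases hx : ∃ i, x ∈ U i ∨ x' ∈ U i
      · obtain ⟨i, hx⟩ := hx
        have hi := congr_fun hxx i
        by_cases h1 : x ∈ U i
        · by_cases h2 : x' ∈ U i
          · exact Or.inl (hq2 i x x' h1 h2 hi)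
          · exact (hq1 i x h1 (hi.trans (hq0 i x' h2))).elim
        · exact (hq1 i x' (hx.resolve_left h1) (hi.symm.trans (hq0 i x h1))).elim
      · push Not at hx
        exact Or.inr ⟨(hUY x).2 fun i => (hx i).1, (hUY x').2 fun i => (hx i).2⟩
    · rintro (rfl | ⟨h1, h2⟩)
      · rfl
      · ext1 i
        rw [hq0 i x ((hUY x).1 h1 i), hq0 i x' ((hUY x').1 h2 i)]

/-! ### Logarithmic coordinates on open cells. -/

section OpenCell

variable {V W : Type*} [Fintype W] [DecidableEq W] (f : W → V) (g : V → W)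

/-- The colors that are not chosen representatives of their class. -/
abbrev NonRep : Type _ := {a : W // g (f a) ≠ a}

theorem card_nonRep [Fintype V] (hg : ∀ v, f (g v) = v) :
    Fintype.card (NonRep f g) = Fintype.card W - Fintype.card V := by
  have h : Fintype.card {a : W // g (f a) = a} = Fintype.card V :=
    Fintype.card_congr ⟨fun a => f a.1, fun v => ⟨g v, by rw [hg]⟩, fun a => Subtype.ext a.2, hg⟩
  rw [← h]
  exact Fintype.card_subtype_compl _

variable [DecidableEq V]

/-- Extend by zero to the representatives. -/
def extendNonRep (w : NonRep f g → ℝ) (a : W) : ℝ :=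
  if h : g (f a) ≠ a then w ⟨a, h⟩ else 0

/-- The point with logarithmic coordinates `w` in the open cell of the partition into the fibers of
`f`. -/
noncomputable def softmax (w : NonRep f g → ℝ) (v : V) (a : W) : ℝ :=
  if f a = v then Real.exp (extendNonRep f g w a) /
    ∑ b with f b = v, Real.exp (extendNonRep f g w b) else 0

variable {f g}

theorem softmax_denom_pos (hg : ∀ v, f (g v) = v) (w : NonRep f g → ℝ) (v : V) :
    0 < ∑ b with f b = v, Real.exp (extendNonRep f g w b) :=
  Finset.sum_pos (fun b _ => Real.exp_pos _) ⟨g v, by simp [hg]⟩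

theorem softmax_pos_iff (hg : ∀ v, f (g v) = v) (w : NonRep f g → ℝ) (v : V) (a : W) :
    0 < softmax f g w v a ↔ f a = v := by
  have := softmax_denom_pos hg w v
  by_cases h : f a = v
  · simp only [softmax, h, if_true, iff_true]
    positivity
  · simp [softmax, h]

theorem softmax_mem_stdSimplex (hg : ∀ v, f (g v) = v) (w : NonRep f g → ℝ) (v : V) :
    softmax f g w v ∈ stdSimplex ℝ W := by
  have := softmax_denom_pos hg w v
  refine ⟨fun a => ?_, ?_⟩
  · by_cases h : f a = v
    · exact ((softmax_pos_iff hg w v a).2 h).le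
    · simp [softmax, h]
  · simp only [softmax, ← Finset.sum_filter, ← Finset.sum_div]
    exact div_self this.ne'

theorem continuous_softmax (hg : ∀ v, f (g v) = v) : Continuous (softmax f g) := by
  have hext (a : W) : Continuous fun w => extendNonRep f g w a := by
    unfold extendNonRep
    split_ifs <;> fun_prop
  refine continuous_pi fun v => continuous_pi fun a => ?_
  unfold softmax
  split_ifs
  · exact (Real.continuous_exp.comp (hext a)).div
      (continuous_finsetSum _ fun b _ => Real.continuous_exp.comp (hext b))
      fun w => (softmax_denom_pos hg w v).ne'
  · exact continuous_const

/-- The coordinates are logarithms of the ratio of each weight to that of the representative of its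
class. Since the weights of a class sum to `1`, `softmax` inverts them. -/
theorem exists_homeomorph_openCell {X : Set (V → W → ℝ)} {t : V → Finset W}
    (hg : ∀ v, f (g v) = v) (ht : ∀ v a, a ∈ t v ↔ f a = v)
    (hX : ∀ x : V → W → ℝ, (∀ v, x v ∈ stdSimplex ℝ W) → posSupport x = t → x ∈ X)
    (hX' : ∀ x ∈ X, ∀ v, x v ∈ stdSimplex ℝ W) :
    Nonempty ({x : X | posSupport x.1 = t} ≃ₜ (NonRep f g → ℝ)) := by
  have hpos {x : V → W → ℝ} (hx : posSupport x = t) (v a) : 0 < x v a ↔ f a = v := by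
    rw [← ht, ← hx, mem_posSupport]
  have hsupp (w : NonRep f g → ℝ) : posSupport (softmax f g w) = t := by
    ext v a
    rw [mem_posSupport, softmax_pos_iff hg, ht]
  refine ⟨⟨⟨fun x a => Real.log (x.1.1 (f a) a) - Real.log (x.1.1 (f a) (g (f a))),
    fun w => ⟨⟨softmax f g w, hX _ (softmax_mem_stdSimplex hg w) (hsupp w)⟩, hsupp w⟩,
    fun x => ?_, fun w => ?_⟩, ?_, ?_⟩⟩
  · refine Subtype.ext (Subtype.ext ?_)
    obtain ⟨⟨x, hx⟩, hxt⟩ := x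
    replace hxt : posSupport x = t := hxt
    have hexp (a : W) : Real.exp (extendNonRep f g (fun a : NonRep f g =>
        Real.log (x (f a) a) - Real.log (x (f a) (g (f a)))) a) =
        x (f a) a / x (f a) (g (f a)) := by
      have h1 := (hpos hxt (f a) a).2 rfl
      have h2 := (hpos hxt (f a) (g (f a))).2 (hg _)
      by_cases h : g (f a) = a
      · rw [extendNonRep, dif_neg (not_not.2 h), h, div_self h1.ne', Real.exp_zero]
      · rw [extendNonRep, dif_pos h, Real.exp_sub, Real.exp_log h1, Real.exp_log h2]
    ext v a
    have h2 := (hpos hxt v (g v)).2 (hg _)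
    have hsum : ∑ b with f b = v, x (f b) b / x (f b) (g (f b)) = 1 / x v (g v) := by
      rw [← (hX' x hx v).2, Finset.sum_div, Finset.sum_filter]
      refine Finset.sum_congr rfl fun b _ => ?_
      split_ifs with h
      · rw [h]
      · have : x v b = 0 := le_antisymm (not_lt.1 fun h' => h ((hpos hxt v b).1 h'))
          ((hX' x hx v).1 b)
        simp [this]
    simp only [softmax, hexp, hsum]
    split_ifs with h
    · subst h
      field_simp
    · exact le_antisymm ((hX' x hx v).1 a) (not_lt.1 fun h' => h ((hpos hxt v a).1 h'))
  · ext ⟨a, ha⟩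
    have hd := softmax_denom_pos hg w (f a)
    have h0 : extendNonRep f g w (g (f a)) = 0 := by simp [extendNonRep, hg]
    have h1 : extendNonRep f g w a = w ⟨a, ha⟩ := by simp [extendNonRep, ha]
    simp only [softmax, hg, if_true]
    rw [Real.log_div (Real.exp_pos _).ne' hd.ne', Real.log_div (Real.exp_pos _).ne' hd.ne',
      Real.log_exp, Real.log_exp, h0, h1]
    ring
  · refine continuous_pi fun a => ?_
    have hc (v b) : Continuous fun x : {x : X | posSupport x.1 = t} => x.1.1 v b :=
      (continuous_apply_apply v b).comp (continuous_subtype_val.comp continuous_subtype_val)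
    exact ((hc _ _).log fun x => ((hpos x.2 _ _).2 rfl).ne').sub
      ((hc _ _).log fun x => ((hpos x.2 _ _).2 (hg _)).ne')
  · exact ((continuous_softmax hg).subtype_mk _).subtype_mk _

end OpenCell

/-! ### Assembly. -/

theorem nonempty_homotopyEquiv_realization_colorings {V W : Type*} [Fintype V] [Fintype W]
    [DecidableEq V] [DecidableEq W] {β : V → W} {Y : Set (V → Finset W)}
    (hY : IsCore Finset.univ Finset.univ β Y) :
    Nonempty (realization (colorings Finset.univ Finset.univ β) ≃ₕ
      SphereWedge (colorings Finset.univ Finset.univ β \ Y).ncard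
        (Fintype.card W - Fintype.card V)) := by
  classical
  set B := colorings (Finset.univ : Finset V) (Finset.univ : Finset W) β
  let ε : Fin (B \ Y).ncard ≃ ↥(B \ Y) :=
    (Finite.equivFinOfCardEq (Nat.card_coe_set_eq (B \ Y))).symm
  have hcolor (i) (a : W) : ∃ v, a ∈ (ε i).1 v := by
    by_contra! h
    exact (ε i).2.2 (hY.mem_of_omitsColor _ (ε i).2.1 ⟨a, by simp, fun v _ => h v⟩)
  choose f hf using hcolor
  choose g hg using fun i v => (ε i).2.1.1 v
  have hdisj {s : V → Finset W} (hs : s ∈ B) {v w a} (h1 : a ∈ s v) (h2 : a ∈ s w) : v = w :=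
    by_contra fun hvw =>
      Finset.disjoint_left.1 (hs.2.2.2 v (by simp) w (by simp) hvw) h1 h2
  have hft (i v a) : a ∈ (ε i).1 v ↔ f i a = v :=
    ⟨fun h => hdisj (ε i).2.1 (hf i a) h, fun h => h ▸ hf i a⟩
  have hfg (i v) : f i (g i v) = v := (hft i v _).1 (hg i v)
  have φ (i) := (exists_homeomorph_openCell (X := realization B) (hfg i) (hft i)
    (fun x hx hxt => ⟨hx, hxt ▸ (ε i).2.1⟩) fun x hx => hx.1).some
  have := hY.contractible
  refine nonempty_homotopyEquiv_wedge (isCompact_realization isFaceClosed_colorings)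
    (realization_mono hY.subset)
    (hasNullDeformation_realization isFaceClosed_colorings hY.isFaceClosed hY.subset)
    (fun i => {x : realization B | posSupport x.1 = (ε i).1}) (fun i => ?_)
    (fun i j x hi hj => ε.injective (Subtype.ext (hi.symm.trans hj))) (fun x => ?_)
    (fun i => ?_) φ
  -- Positivity on all pairs `(f i a, a)` already determines the support: each color is in use, and
  -- disjointness excludes any further vertex.
  · have : {x : realization B | posSupport x.1 = (ε i).1} =
        ⋂ a, {x : realization B | 0 < x.1 (f i a) a} := by
      ext x
      simp only [Set.mem_ofPred_eq, Set.mem_iInter]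
      refine ⟨fun h a => mem_posSupport.1 (h ▸ hf i a), fun h => ?_⟩
      ext v a
      rw [hft]
      refine ⟨fun ha => hdisj x.2.2 (mem_posSupport.2 (h a)) ha, ?_⟩
      rintro rfl
      exact mem_posSupport.2 (h a)
    rw [this]
    exact isOpen_iInter_of_finite fun a => isOpen_lt continuous_const
      ((continuous_apply_apply _ a).comp continuous_subtype_val)
  · refine ⟨fun hx i hi => ?_, fun h => ⟨x.2.1, by_contra fun hn => ?_⟩⟩
    · have hmem := (ε i).2.2
      rw [← show posSupport x.1 = (ε i).1 from hi] at hmem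
      exact hmem hx.2
    · exact h (ε.symm ⟨_, x.2.2, hn⟩) (by rw [Equiv.apply_symm_apply]; rfl)
  · rw [Module.finrank_fintype_fun_eq_card, card_nonRep _ _ (hfg i)]

theorem homComplex_top_eq_realization {V W : Type*} [Fintype V] [Fintype W] (β : V → W) :
    HomComplex (⊤ : SimpleGraph V) (⊤ : SimpleGraph W) =
      realization (colorings Finset.univ Finset.univ β) := by
  have hcell (η : V → Finset W) : IsHomCell (⊤ : SimpleGraph V) (⊤ : SimpleGraph W) η ↔
      η ∈ colorings Finset.univ Finset.univ β := by
    simp only [IsHomCell, colorings, SimpleGraph.top_adj, Finset.mem_univ, not_true_eq_false,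
      false_imp_iff, implies_true, Finset.subset_univ, true_and, forall_const, Set.mem_ofPred_eq,
      Finset.disjoint_left]
    refine and_congr_right fun _ => forall_congr' fun v => forall_congr' fun w =>
      forall_congr' fun _ => ⟨fun h a ha hb => h a ha a hb rfl, ?_⟩
    rintro h a ha _ hb rfl
    exact h ha hb
  ext x
  simp only [HomComplex, Set.mem_iUnion, Set.mem_ofPred_eq, exists_prop, homClosedCell, hcell]
  refine ⟨?_, fun hx => ⟨posSupport x, hx.2, fun v => ⟨hx.1 v, fun a ha => ?_⟩⟩⟩
  · rintro ⟨η, hη, hx⟩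
    refine ⟨fun v => (hx v).1, isFaceClosed_colorings η hη _ (fun v a ha => ?_) fun v =>
      posSupport_nonempty (hx v).1⟩
    by_contra hn
    rw [mem_posSupport, (hx v).2 a hn] at ha
    exact ha.false
  · rw [mem_posSupport, not_lt] at ha
    exact le_antisymm ha ((hx.1 v).1 a)

theorem mainTheorem4 (m n : ℕ) (hmn : m ≤ n) :
    ∃ k : ℕ, (2 ≤ m → 1 ≤ k) ∧
      Nonempty
        (HomComplex (⊤ : SimpleGraph (Fin m)) (⊤ : SimpleGraph (Fin n)) ≃ₕ
          SphereWedge k (n - m)) := by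
  -- `β` matters only off `M`, and `M` is everything here, so any map `Fin m → Fin n` would do.
  obtain ⟨Y, hY⟩ := exists_isCore Finset.univ Finset.univ (Fin.castLE hmn) (by simpa using hmn)
  refine ⟨(colorings Finset.univ Finset.univ (Fin.castLE hmn) \ Y).ncard, fun h2 => ?_, ?_⟩
  · obtain ⟨s, hs, hsY⟩ := hY.exists_notMem (by simpa using h2)
    exact (Set.ncard_pos (Set.toFinite _)).2 ⟨s, hs, hsY⟩
  · rw [homComplex_top_eq_realization (Fin.castLE hmn)]
    have h := nonempty_homotopyEquiv_realization_colorings hY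
    rwa [Fintype.card_fin, Fintype.card_fin] at h
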